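/- Let $\mathbb M^{3\times3}$ be the space of real $3\times 3$ matrices with the Euclidean norm $|\xi|=(\sum_{i,j}\xi_{ij}^2)^{1/2}$, let $Y=\,]0,1[^3$ and let $p\in\,]1,+\infty[$. Let $\mathrm{Aff}_0(Y;\mathbb R^3)$ be the set of all continuous $\phi:\overline Y\to\mathbb R^3$ with $\phi=0$ on $\partial Y$ which are piecewise affine in the following sense: $\phi$ is Lipschitz on $Y$ and there are finitely many pairwise disjoint open sets $D_i\subset Y$ with $|Y\setminus\bigcup_i D_i|=0$ such that $\phi$ is differentiable with constant gradient on each $D_i$. For a Borel measurable function $W:\mathbb M^{3\times3}\to[0,+\infty]$ put $$\mathcal ZW(\xi)=\inf\Big\{\int_Y W(\xi+\nabla\phi(y))\,dy:\ \phi\in \mathrm{Aff}_0(Y;\mathbb R^3)\Big\}.$$ **Proposition 1.8.** Let $W:\mathbb M^{3\times3}\to[0,+\infty]$ be Borel measurable and suppose that - (C$_3$) for every $\delta>0$ there is $c_\delta>0$ such that for every $\xi\in\mathbb M^{3\times3}$, if $|\det\xi|\ge\delta$ then $W(\xi)\le c_\delta(1+|\xi|^p)$; - (C$_4$) $W(P\xi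 Q)=W(\xi)$ for all $\xi\in\mathbb M^{3\times3}$ and all $P,Q\in SO(3)$. Then $\mathcal ZW$ is of $p$-polynomial growth: there is $c>0$ such that $\mathcal ZW(\xi)\le c(1+|\xi|^p)$ for all $\xi\in\mathbb M^{3\times3}$. -/

import Mathlib

open MeasureTheory
open scoped ENNReal

noncomputable section

namespace Relax

/-- The σ-algebra on real matrices is the product one, that is, the Borel σ-algebra. -/
instance instMeasurableSpaceMatrix (m N : ℕ) : MeasurableSpace (Matrix (Fin m) (Fin N) ℝ) :=
  inferInstanceAs (MeasurableSpace (Fin m → Fin N → ℝ))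

instance instBorelSpaceMatrix (m N : ℕ) : BorelSpace (Matrix (Fin m) (Fin N) ℝ) :=
  inferInstanceAs (BorelSpace (Fin m → Fin N → ℝ))

/-- The Euclidean norm `|ξ| = (∑ ξᵢⱼ²)^(1/2)` of a real matrix. -/
def matNorm {m N : ℕ} (ξ : Matrix (Fin m) (Fin N) ℝ) : ℝ :=
  Real.sqrt (∑ i, ∑ j, ξ i j ^ 2)

/-- The Jacobian matrix of `u : ℝ^N → ℝ^m` at `x`: the entry `(i, j)` is `∂uᵢ/∂xⱼ (x)`. -/
def grad {m N : ℕ} (u : EuclideanSpace ℝ (Fin N) → EuclideanSpace ℝ (Fin m))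
    (x : EuclideanSpace ℝ (Fin N)) : Matrix (Fin m) (Fin N) ℝ :=
  Matrix.of fun i j => fderiv ℝ u x (EuclideanSpace.single j 1) i

/-- Continuous piecewise affine maps on an open set `D`: there are finitely many disjoint open
subsets `U₁, …, Uₙ` of `D`, covering `D` up to a Lebesgue-null set, such that `u` is differentiable
on each `Uᵢ` with constant gradient `ξᵢ`.  (The `Uᵢ` need be neither connected nor polyhedral.)
Lipschitz continuity on `D` expresses that the piecewise constant gradient is the weak gradient of
`u`, so that `u` belongs to `W^{1,∞}`: on a convex bounded open set, a continuous `u` as above is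
Lipschitz if and only if it is a Sobolev function.  It excludes maps of Cantor-Lebesgue type. -/
def IsPiecewiseAffine {m N : ℕ} (D : Set (EuclideanSpace ℝ (Fin N)))
    (u : EuclideanSpace ℝ (Fin N) → EuclideanSpace ℝ (Fin m)) : Prop :=
  (∃ K, LipschitzOnWith K u D) ∧
  ∃ (n : ℕ) (U : Fin n → Set (EuclideanSpace ℝ (Fin N)))
    (ξ : Fin n → Matrix (Fin m) (Fin N) ℝ),
    (∀ i, IsOpen (U i) ∧ U i ⊆ D) ∧
    (∀ i j, i ≠ j → Disjoint (U i) (U j)) ∧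
    volume (D \ ⋃ i, U i) = 0 ∧
    ∀ i, ∀ x ∈ U i, DifferentiableAt ℝ u x ∧ grad u x = ξ i

/-- `Aff₀(D; ℝ^m)`: continuous piecewise affine maps on `D` that are continuous up to the boundary
and vanish there.  (Values of `u` outside the closure of `D` are irrelevant.) -/
def Aff₀ {N : ℕ} (m : ℕ) (D : Set (EuclideanSpace ℝ (Fin N))) :
    Set (EuclideanSpace ℝ (Fin N) → EuclideanSpace ℝ (Fin m)) :=
  {u | IsPiecewiseAffine D u ∧ ContinuousOn u (closure D) ∧ ∀ x ∈ frontier D, u x = 0}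

/-- The open unit cube `]0,1[^N`. -/
def unitCube (N : ℕ) : Set (EuclideanSpace ℝ (Fin N)) :=
  {x | ∀ i, 0 < x i ∧ x i < 1}

/-- `𝒵f(ξ) = inf { ∫_Y f(ξ + ∇φ(y)) dy : φ ∈ Aff₀(Y; ℝ^m) }`, with `Y` the open unit cube. -/
def Z {m N : ℕ} (f : Matrix (Fin m) (Fin N) ℝ → ℝ≥0∞) (ξ : Matrix (Fin m) (Fin N) ℝ) : ℝ≥0∞ :=
  ⨅ φ ∈ Aff₀ m (unitCube N), ∫⁻ y in unitCube N, f (ξ + grad φ y)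

/-- `p`-polynomial growth: `f(ξ) ≤ c (1 + |ξ|^p)` for all `ξ` and some `c > 0`. -/
def HasPolynomialGrowth {m N : ℕ} (p : ℝ) (f : Matrix (Fin m) (Fin N) ℝ → ℝ≥0∞) : Prop :=
  ∃ c : ℝ, 0 < c ∧ ∀ ξ, f ξ ≤ ENNReal.ofReal (c * (1 + matNorm ξ ^ p))

/-- For every `δ > 0` there is `c_δ > 0` with `W(ξ) ≤ c_δ (1 + |ξ|^p)` whenever `|det ξ| ≥ δ`. -/
def CondC₃ (p : ℝ) (W : Matrix (Fin 3) (Fin 3) ℝ → ℝ≥0∞) : Prop :=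
  ∀ δ : ℝ, 0 < δ → ∃ c : ℝ, 0 < c ∧ ∀ ξ : Matrix (Fin 3) (Fin 3) ℝ,
    δ ≤ |ξ.det| → W ξ ≤ ENNReal.ofReal (c * (1 + matNorm ξ ^ p))

/-- `W(PξQ) = W(ξ)` for all `ξ` and all `P, Q ∈ SO(3)`. -/
def CondC₄ (W : Matrix (Fin 3) (Fin 3) ℝ → ℝ≥0∞) : Prop :=
  ∀ ξ : Matrix (Fin 3) (Fin 3) ℝ,
    ∀ P ∈ Matrix.specialOrthogonalGroup (Fin 3) ℝ,
    ∀ Q ∈ Matrix.specialOrthogonalGroup (Fin 3) ℝ, W (P * ξ * Q) = W ξ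

end Relax

end

namespace Relax

/-! One Lipschitz map `u`, vanishing outside the cube, whose gradient takes finitely many values `η
i`, all invertible, serves every `ξ` as test map `t • u`. With `t` a large multiple of `1 + |ξ|`, `ξ
+ t • η i = t • (η i + t⁻¹ • ξ)` is `t` times a small perturbation of `η i`: its determinant stays
away from zero uniformly in `ξ`, and its norm is at most `C * (1 + |ξ|)`. So `CondC₃` with a single
`δ` bounds the integrand.

To build `u`, fill the open set with disjoint sup-norm balls up to a null set; the tent over each
has gradients `± e_i`. Precomposing with an invertible `A` turns these into signed rows of `A`.
Using a different Vandermonde matrix for each component, all nodes distinct, any choice of one row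
per component is again invertible. -/

/-! ### Tents over sup-norm balls -/

theorem addHaar_setOf_sub_eq_mul_sub {ι : Type*} [Fintype ι] (μ : Measure (ι → ℝ))
    [μ.IsAddHaarMeasure] (c : ι → ℝ) {i j : ι} (hij : i ≠ j) (a : ℝ) :
    μ {z | z i - c i = a * (z j - c j)} = 0 := by
  classical
  let S : Submodule ℝ (ι → ℝ) :=
    LinearMap.ker (LinearMap.proj (R := ℝ) (φ := fun _ : ι => ℝ) i - a • LinearMap.proj j)
  have hS : S ≠ ⊤ := by
    intro h
    have : (Pi.single i 1 : ι → ℝ) ∈ S := h ▸ Submodule.mem_top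
    simp [S, LinearMap.mem_ker, Pi.single_eq_of_ne hij.symm] at this
  have h0 : μ ((fun z => z + -c) ⁻¹' (S : Set (ι → ℝ))) = 0 := by
    rw [measure_preimage_add_right]
    exact Measure.addHaar_submodule μ S hS
  refine measure_mono_null (fun z hz => ?_) h0
  simp only [Set.mem_ofPred_eq] at hz
  simp only [S, Set.mem_preimage, SetLike.mem_coe, LinearMap.mem_ker, LinearMap.sub_apply,
    LinearMap.smul_apply, LinearMap.proj_apply, Pi.add_apply, Pi.neg_apply, smul_eq_mul]
  linarith

/-- The distance to the complement of a disjoint union of balls is a tent on each of them. -/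
theorem infDist_compl_iUnion_ball {E : Type*} [NormedAddCommGroup E] [NormedSpace ℝ E]
    [Nontrivial E] {t : Set E} {r : E → ℝ}
    (ht : t.PairwiseDisjoint fun x => Metric.closedBall x (r x))
    {c z : E} (hc : c ∈ t) (hz : z ∈ Metric.ball c (r c)) :
    Metric.infDist z (⋃ x ∈ t, Metric.ball x (r x))ᶜ = r c - ‖z - c‖ := by
  have hzr : ‖z - c‖ < r c := by simpa [dist_eq_norm] using hz
  have hr : 0 < r c := (norm_nonneg _).trans_lt hzr
  have hsphere : ∀ w, ‖w - c‖ = r c → w ∈ (⋃ x ∈ t, Metric.ball x (r x))ᶜ := by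
    intro w hw hmem
    simp only [Set.mem_iUnion] at hmem
    obtain ⟨x, hx, hwx⟩ := hmem
    by_cases hxc : x = c
    · subst hxc
      rw [Metric.mem_ball, dist_eq_norm] at hwx
      exact hwx.ne hw
    · refine Set.disjoint_left.1 (ht hx hc hxc) (Metric.ball_subset_closedBall hwx) ?_
      simp [dist_eq_norm, hw]
  -- The radial projection of `z` to the sphere; at the centre any direction will do.
  have hexit : ∃ w, ‖w - c‖ = r c ∧ dist z w = r c - ‖z - c‖ := by
    by_cases h0 : z = c
    · obtain ⟨v, hv⟩ := exists_norm_eq E hr.le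
      exact ⟨c + v, by simpa using hv, by simp [h0, dist_eq_norm, hv]⟩
    · have hpos : 0 < ‖z - c‖ := norm_pos_iff.2 (sub_ne_zero.2 h0)
      refine ⟨c + (r c / ‖z - c‖) • (z - c), ?_, ?_⟩
      · rw [add_sub_cancel_left, norm_smul, Real.norm_of_nonneg (by positivity),
          div_mul_cancel₀ _ hpos.ne']
      · have : z - (c + (r c / ‖z - c‖) • (z - c)) = (1 - r c / ‖z - c‖) • (z - c) := by
          rw [sub_smul, one_smul]; abel
        have h1 : 1 - r c / ‖z - c‖ ≤ 0 := by
          rw [sub_nonpos, le_div_iff₀ hpos]; linarith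
        rw [dist_eq_norm, this, norm_smul, Real.norm_of_nonpos h1]
        field_simp
        ring
  obtain ⟨w, hw, hd⟩ := hexit
  refine le_antisymm (hd ▸ Metric.infDist_le_dist_of_mem (hsphere w hw)) ?_
  refine (Metric.le_infDist ⟨w, hsphere w hw⟩).2 fun y hy => ?_
  have hyr : r c ≤ ‖y - c‖ := by
    by_contra! h
    exact hy (Set.mem_biUnion hc (by simpa [dist_eq_norm] using h))
  have := norm_sub_norm_le (y - c) (z - c)
  rw [sub_sub_sub_cancel_right] at this
  rw [dist_comm, dist_eq_norm]
  linarith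

/-- On the open cone where one signed coordinate dominates, the sup norm is linear; hence tents are
affine there. -/
theorem norm_eq_mul_of_abs_lt {ι : Type*} [Fintype ι] {v : ι → ℝ} {i : ι} {s : ℤˣ}
    (h0 : 0 < (s : ℝ) * v i) (h : ∀ j, j ≠ i → |v j| < s * v i) : ‖v‖ = s * v i := by
  have hi : |v i| = s * v i := by
    rcases Int.units_eq_one_or s with rfl | rfl
    · simp only [Units.val_one, Int.cast_one, one_mul] at h0 ⊢
      exact abs_of_pos h0
    · simp only [Units.val_neg, Units.val_one, Int.cast_neg, Int.cast_one, neg_mul, one_mul]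
        at h0 ⊢
      exact abs_of_neg (by linarith)
  refine le_antisymm ((pi_norm_le_iff_of_nonneg h0.le).2 fun j => ?_) ?_
  · by_cases hj : j = i
    · rw [hj, Real.norm_eq_abs, hi]
    · exact (h j hj).le
  · rw [← hi]
    exact norm_le_pi_norm v i

/-- On any open set there is a Lipschitz function vanishing outside whose gradient is
almost everywhere a signed vector of the canonical basis. -/
theorem exists_lipschitz_gradient_mem_basis {ι : Type*} [Fintype ι] [Nonempty ι]
    (μ : Measure (ι → ℝ)) [μ.IsAddHaarMeasure] {Ω : Set (ι → ℝ)} (hΩ : IsOpen Ω) :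
    ∃ f : (ι → ℝ) → ℝ, LipschitzWith 1 f ∧ (∀ x ∉ Ω, f x = 0) ∧
      ∃ V : ι × ℤˣ → Set (ι → ℝ), (∀ k, IsOpen (V k) ∧ V k ⊆ Ω) ∧
        (∀ k l, k ≠ l → Disjoint (V k) (V l)) ∧ μ (Ω \ ⋃ k, V k) = 0 ∧
        ∀ k, ∀ x ∈ V k, HasFDerivAt f
          ((k.2 : ℝ) • ContinuousLinearMap.proj (R := ℝ) (φ := fun _ : ι => ℝ) k.1) x := by
  obtain ⟨t, r, htc, -, hr, hcov, hdisj⟩ :=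
    Besicovitch.exists_disjoint_closedBall_covering_ae μ
      (fun x => {ρ | Metric.closedBall x ρ ⊆ Ω}) Ω (by
        intro x hx δ hδ
        obtain ⟨ε, hε, hball⟩ := Metric.isOpen_iff.1 hΩ x hx
        refine ⟨min ε δ / 2, ?_, by positivity, ?_⟩
        · refine (Metric.closedBall_subset_ball ?_).trans hball
          have := min_le_left ε δ
          linarith [lt_min hε hδ]
        · have := min_le_right ε δ
          linarith [lt_min hε hδ]) (fun _ => 1) (by simp)
  have hsub : ∀ c ∈ t, Metric.ball c (r c) ⊆ Ω := fun c hc =>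
    Metric.ball_subset_closedBall.trans (hr c hc).1
  set B : Set (ι → ℝ) := ⋃ x ∈ t, Metric.ball x (r x) with hB
  have hBΩ : B ⊆ Ω := Set.iUnion₂_subset hsub
  -- The open pyramids of a ball. Using `c - z` instead of `z - c` makes the tent's slope `+k.2`
  -- along axis `k.1`.
  let C : (ι → ℝ) → ι × ℤˣ → Set (ι → ℝ) := fun c k =>
    {z | z ∈ Metric.ball c (r c) ∧ 0 < (k.2 : ℝ) * (c - z) k.1 ∧
      ∀ j, j ≠ k.1 → |(c - z) j| < k.2 * (c - z) k.1}
  have hCnorm : ∀ c k, ∀ z ∈ C c k, ‖c - z‖ = k.2 * (c - z) k.1 := fun c k z hz =>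
    norm_eq_mul_of_abs_lt hz.2.1 hz.2.2
  have hCopen : ∀ c k, IsOpen (C c k) := by
    intro c k
    refine Metric.isOpen_ball.and (IsOpen.and (isOpen_lt continuous_const ?_) ?_)
    · simp only [Pi.sub_apply]; fun_prop
    · simp only [Set.ofPred_forall]
      refine isOpen_iInter_of_finite fun j => isOpen_iInter_of_finite fun _ => ?_
      simp only [Pi.sub_apply]
      exact isOpen_lt (by fun_prop) (by fun_prop)
  refine ⟨fun z => Metric.infDist z Bᶜ, Metric.lipschitz_infDist_pt _, fun x hx => ?_,
    fun k => ⋃ c ∈ t, C c k, fun k => ⟨?_, ?_⟩, fun k l hkl => ?_, ?_, ?_⟩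
  · exact Metric.infDist_zero_of_mem fun h => hx (hBΩ h)
  · exact isOpen_biUnion fun c _ => hCopen c k
  · exact Set.iUnion₂_subset fun c hc z hz => hsub c hc hz.1
  · rw [Set.disjoint_left]
    intro z hzk hzl
    simp only [Set.mem_iUnion] at hzk hzl
    obtain ⟨c, hc, hzk⟩ := hzk
    obtain ⟨d, hd, hzl⟩ := hzl
    obtain rfl : c = d := by
      by_contra hcd
      exact Set.disjoint_left.1 (hdisj hc hd hcd) (Metric.ball_subset_closedBall hzk.1)
        (Metric.ball_subset_closedBall hzl.1)
    have h1 := hCnorm c k z hzk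
    have h2 := hCnorm c l z hzl
    -- Two dominant axes would give `‖c - z‖ < ‖c - z‖`.
    have hfst : k.1 = l.1 := by
      by_contra hne'
      have := hzk.2.2 l.1 (Ne.symm hne')
      rw [← h1] at this
      have h3 : |((l.2 : ℤ) : ℝ) * (c - z) l.1| = |(c - z) l.1| := by
        rcases Int.units_eq_one_or l.2 with h | h <;> simp [h, abs_sub_comm]
      rw [← h3, ← h2, abs_of_nonneg (norm_nonneg _)] at this
      exact lt_irrefl _ this
    apply hkl
    refine Prod.ext hfst ?_
    have hk0 := hzk.2.1
    have hl0 := hzl.2.1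
    rw [hfst] at hk0
    rcases Int.units_eq_one_or k.2 with h | h <;> rcases Int.units_eq_one_or l.2 with h' | h' <;>
      rw [h, h'] <;> simp only [h, h', Units.val_neg, Units.val_one, Int.cast_neg, Int.cast_one,
        neg_mul, one_mul] at hk0 hl0 <;> linarith
  -- What the pyramids miss in the balls: spheres, centres, and the hyperplanes where two
  -- coordinates tie in absolute value.
  · have hnull : μ (⋃ c ∈ t, (Metric.sphere c (r c) ∪ {c} ∪
        ⋃ (i : ι) (j : ι) (_ : i ≠ j) (s : ℤˣ), {z | z i - c i = (s : ℝ) * (z j - c j)})) = 0 := by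
      rw [measure_biUnion_null_iff htc]
      intro c hc
      simp only [measure_union_null_iff, measure_iUnion_null_iff]
      exact ⟨⟨Measure.addHaar_sphere μ c (r c), measure_singleton c⟩, fun i j hij s =>
        addHaar_setOf_sub_eq_mul_sub μ c hij _⟩
    refine measure_mono_null (fun z hz => ?_) (measure_union_null hcov hnull)
    by_cases hzc : z ∈ ⋃ x ∈ t, Metric.closedBall x (r x)
    swap
    · exact Or.inl ⟨hz.1, hzc⟩
    right
    simp only [Set.mem_iUnion] at hzc
    obtain ⟨c, hc, hzc⟩ := hzc
    refine Set.mem_biUnion hc ?_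
    by_contra hnot
    simp only [Set.mem_union, Set.mem_iUnion, Set.mem_ofPred_eq, Set.mem_singleton_iff, not_or,
      not_exists] at hnot
    obtain ⟨⟨hsph, hzne⟩, hplane⟩ := hnot
    have hball : z ∈ Metric.ball c (r c) :=
      lt_of_le_of_ne hzc hsph
    obtain ⟨i, hi⟩ : ∃ i, ∀ j, |(c - z) j| ≤ |(c - z) i| := Finite.exists_max _
    have hi0 : (c - z) i ≠ 0 := by
      intro h0
      apply hzne
      ext j
      have := hi j
      rw [h0, abs_zero] at this
      have := abs_nonpos_iff.1 this
      rw [Pi.sub_apply] at this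
      linarith
    obtain ⟨s, hs⟩ : ∃ s : ℤˣ, |(c - z) i| = (s : ℝ) * (c - z) i := by
      rcases le_total 0 ((c - z) i) with h | h
      · exact ⟨1, by simpa using abs_of_nonneg h⟩
      · exact ⟨-1, by simpa using abs_of_nonpos h⟩
    refine hz.2 (Set.mem_iUnion.2 ⟨(i, s), Set.mem_biUnion hc ⟨hball, ?_, fun j hj => ?_⟩⟩)
    · rw [← hs]; exact abs_pos.2 hi0
    · rw [← hs]
      refine lt_of_le_of_ne (hi j) fun habs => ?_
      rcases abs_eq_abs.1 habs with h | h
      · refine hplane j i hj 1 ?_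
        simp only [Pi.sub_apply] at h
        simp only [Units.val_one, Int.cast_one]
        linarith
      · refine hplane j i hj (-1) ?_
        simp only [Pi.sub_apply] at h
        simp only [Units.val_neg, Units.val_one, Int.cast_neg, Int.cast_one]
        linarith
  · intro k z hz
    simp only [Set.mem_iUnion] at hz
    obtain ⟨c, hc, hz⟩ := hz
    let T := (k.2 : ℝ) • ContinuousLinearMap.proj (R := ℝ) (φ := fun _ : ι => ℝ) k.1
    have hT : HasFDerivAt (fun w => r c - T c + T w) T z := T.hasFDerivAt.const_add _
    refine hT.congr_of_eventuallyEq ?_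
    filter_upwards [(hCopen c k).mem_nhds hz] with w hw
    rw [infDist_compl_iUnion_ball hdisj hc hw.1, norm_sub_rev, hCnorm c k w hw]
    simp only [T, smul_apply, ContinuousLinearMap.proj_apply, smul_eq_mul,
      Pi.sub_apply]
    ring

/-! ### From scalar tents to invertible gradients -/

/-- On any open set there is a Lipschitz function vanishing outside whose gradient is
almost everywhere a signed row of a given invertible matrix. -/
theorem exists_lipschitz_gradient_mem_rows {N : ℕ} [NeZero N] {A : Matrix (Fin N) (Fin N) ℝ}
    (hA : A.det ≠ 0) {Ω : Set (EuclideanSpace ℝ (Fin N))} (hΩ : IsOpen Ω) :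
    ∃ f : EuclideanSpace ℝ (Fin N) → ℝ, (∃ K, LipschitzWith K f) ∧ (∀ x ∉ Ω, f x = 0) ∧
      ∃ V : Fin N × ℤˣ → Set (EuclideanSpace ℝ (Fin N)), (∀ k, IsOpen (V k) ∧ V k ⊆ Ω) ∧
        (∀ k l, k ≠ l → Disjoint (V k) (V l)) ∧ volume (Ω \ ⋃ k, V k) = 0 ∧
        ∀ k, ∀ x ∈ V k, DifferentiableAt ℝ f x ∧
          ∀ j, fderiv ℝ f x (EuclideanSpace.single j 1) = k.2 * A k.1 j := by
  have hinj : Function.Injective (Matrix.toLin' A) :=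
    Matrix.mulVec_injective_iff_isUnit.2 ((Matrix.isUnit_iff_isUnit_det A).2 hA.isUnit)
  let L : EuclideanSpace ℝ (Fin N) ≃L[ℝ] (Fin N → ℝ) := (EuclideanSpace.equiv (Fin N) ℝ).trans
    (LinearEquiv.ofInjectiveEndo (Matrix.toLin' A) hinj).toContinuousLinearEquiv
  have hL : ∀ x, L x = A.mulVec x.ofLp := fun x => rfl
  have hopen : IsOpen (L.symm ⁻¹' Ω) := hΩ.preimage L.symm.continuous
  obtain ⟨f, hf, hf0, V, hV, hdisj, hcov, hder⟩ :=
    -- The image measure under `L` is again Haar, and its null sets pull back to Lebesgue-null sets.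
    exists_lipschitz_gradient_mem_basis (volume.map L) hopen
  have hmem : ∀ x, L x ∈ L.symm ⁻¹' Ω ↔ x ∈ Ω := fun x => by simp
  refine ⟨f ∘ L, ⟨_, hf.comp L.lipschitz⟩, fun x hx => hf0 _ ((hmem x).not.2 hx),
    fun k => L ⁻¹' V k, fun k => ⟨(hV k).1.preimage L.continuous, fun x hx =>
      (hmem x).1 ((hV k).2 hx)⟩, fun k l hkl => (hdisj k l hkl).preimage _, ?_, ?_⟩
  · rw [Measure.map_apply L.continuous.measurable (hopen.measurableSet.diff
      (isOpen_iUnion fun k => (hV k).1).measurableSet)] at hcov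
    rw [← hcov]
    congr 1
    ext x
    simp
  · intro k x hx
    have h := (hder k _ hx).comp x L.hasFDerivAt
    refine ⟨h.differentiableAt, fun j => ?_⟩
    rw [h.fderiv]
    simp [hL]

/-- On any open set of `ℝ^N` there is a Lipschitz map vanishing outside whose gradient
takes almost everywhere finitely many values, all of them invertible. -/
theorem exists_lipschitz_piecewise_invertible_grad {N : ℕ} [NeZero N]
    {Ω : Set (EuclideanSpace ℝ (Fin N))} (hΩ : IsOpen Ω) :
    ∃ u : EuclideanSpace ℝ (Fin N) → EuclideanSpace ℝ (Fin N),
      (∃ K, LipschitzWith K u) ∧ (∀ x ∉ Ω, u x = 0) ∧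
      ∃ (n : ℕ) (U : Fin n → Set (EuclideanSpace ℝ (Fin N)))
        (η : Fin n → Matrix (Fin N) (Fin N) ℝ),
        (∀ i, IsOpen (U i) ∧ U i ⊆ Ω) ∧ (∀ i j, i ≠ j → Disjoint (U i) (U j)) ∧
        volume (Ω \ ⋃ i, U i) = 0 ∧ (∀ i, (η i).det ≠ 0) ∧
        ∀ i, ∀ x ∈ U i, DifferentiableAt ℝ u x ∧ grad u x = η i := by
  -- `N * N` distinct nodes, `N` for each component, so nodes picked from different components never
  -- coincide.
  let node : Fin N → Fin N → ℝ := fun k i => ((finProdFinEquiv (k, i) : ℕ) : ℝ)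
  have hnode : ∀ g : Fin N → Fin N, Function.Injective fun k => node k (g k) := by
    intro g k l h
    have := finProdFinEquiv.injective (Fin.ext (Nat.cast_injective (R := ℝ) h))
    exact congrArg Prod.fst this
  have hnode' : ∀ k, Function.Injective (node k) := by
    intro k i j h
    have := finProdFinEquiv.injective (Fin.ext (Nat.cast_injective (R := ℝ) h))
    exact congrArg Prod.snd this
  choose f hf hf0 V hV hdisj hcov hder using fun k => exists_lipschitz_gradient_mem_rows
    (Matrix.det_vandermonde_ne_zero_iff.2 (hnode' k)) hΩ
  choose K hK using hf
  -- Pieces of `u` are indexed by the choice of a signed row for each component.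
  let e := (Fintype.equivFin (Fin N → Fin N × ℤˣ)).symm
  refine ⟨fun x => WithLp.toLp 2 fun k => f k x, ?_, fun x hx => ?_,
    Fintype.card (Fin N → Fin N × ℤˣ), fun a => ⋂ k, V k (e a k),
    fun a => Matrix.diagonal (fun k => ((e a k).2 : ℝ)) *
      Matrix.vandermonde fun k => node k (e a k).1,
    fun a => ⟨isOpen_iInter_of_finite fun k => (hV k _).1,
      (Set.iInter_subset _ (0 : Fin N)).trans (hV _ _).2⟩, fun a b hab => ?_, ?_, fun a => ?_,
    fun a x hx => ?_⟩
  · have h1 : LipschitzWith (∑ k, K k) fun x k => f k x :=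
      LipschitzWith.of_dist_le_mul fun x y => (dist_pi_le_iff (by positivity)).2 fun k =>
        ((hK k).dist_le_mul x y).trans (by
          gcongr
          exact Finset.single_le_sum (f := K) (fun _ _ => zero_le) (Finset.mem_univ k))
    exact ⟨_, (PiLp.lipschitzWith_toLp 2 _).comp h1⟩
  · ext k
    simpa using hf0 k x hx
  · obtain ⟨k, hk⟩ := Function.ne_iff.1 (e.injective.ne hab)
    exact (hdisj k _ _ hk).mono (Set.iInter_subset _ k) (Set.iInter_subset _ k)
  · refine measure_mono_null (fun x hx => ?_) (measure_iUnion_null hcov)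
    by_contra hnot
    have hmem : ∀ k, ∃ l, x ∈ V k l := fun k => by
      by_contra! h
      exact hnot (Set.mem_iUnion.2 ⟨k, hx.1, by simpa using h⟩)
    choose g hg using hmem
    exact hx.2 (Set.mem_iUnion.2 ⟨e.symm g, Set.mem_iInter.2 fun k => by simpa using hg k⟩)
  · rw [Matrix.det_mul, Matrix.det_diagonal]
    refine mul_ne_zero (Finset.prod_ne_zero_iff.2 fun k _ => ?_)
      (Matrix.det_vandermonde_ne_zero_iff.2 (hnode _))
    exact_mod_cast (e a k).2.ne_zero
  · rw [Set.mem_iInter] at hx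
    have hd : DifferentiableAt ℝ
        (fun x => (WithLp.toLp 2 fun k => f k x : EuclideanSpace ℝ (Fin N))) x :=
      differentiableAt_euclidean.2 fun k => (hder k _ x (hx k)).1
    refine ⟨hd, ?_⟩
    ext k j
    have hk := (EuclideanSpace.proj k : EuclideanSpace ℝ (Fin N) →L[ℝ] ℝ).hasFDerivAt.comp x
      hd.hasFDerivAt
    have hk' := hk.fderiv
    have := (hder k _ x (hx k)).2 j
    change fderiv ℝ (f k) x = _ at hk'
    rw [hk'] at this
    simpa [grad, Matrix.vandermonde_apply] using this

/-! ### The cube, scaling, and determinant bounds -/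

theorem isOpen_unitCube (N : ℕ) : IsOpen (unitCube N) := by
  simp only [unitCube, Set.ofPred_forall]
  exact isOpen_iInter_of_finite fun i =>
    (isOpen_lt continuous_const (by fun_prop)).and (isOpen_lt (by fun_prop) continuous_const)

theorem volume_unitCube (N : ℕ) : volume (unitCube N) = 1 := by
  have h : unitCube N = WithLp.ofLp ⁻¹' Set.pi Set.univ fun _ : Fin N => Set.Ioo (0 : ℝ) 1 := by
    ext x
    simp [unitCube]
  rw [h, (PiLp.volume_preserving_ofLp (Fin N)).measure_preimage
    (MeasurableSet.univ_pi fun _ => measurableSet_Ioo).nullMeasurableSet, Real.volume_pi_Ioo]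
  simp

theorem grad_smul {m N : ℕ} {u : EuclideanSpace ℝ (Fin N) → EuclideanSpace ℝ (Fin m)}
    {x : EuclideanSpace ℝ (Fin N)} (hu : DifferentiableAt ℝ u x) (t : ℝ) :
    grad (t • u) x = t • grad u x := by
  ext a b
  simp [grad, fderiv_const_smul hu]

theorem smul_mem_Aff₀ {m N : ℕ} {D : Set (EuclideanSpace ℝ (Fin N))}
    {u : EuclideanSpace ℝ (Fin N) → EuclideanSpace ℝ (Fin m)} (hu : u ∈ Aff₀ m D) (t : ℝ) :
    t • u ∈ Aff₀ m D := by
  obtain ⟨⟨⟨K, hK⟩, n, U, η, hU, hdisj, hcov, hη⟩, hcont, hbd⟩ := hu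
  refine ⟨⟨⟨_, (lipschitzWith_smul t).comp_lipschitzOnWith hK⟩, n, U, fun i => t • η i, hU, hdisj,
    hcov, fun i x hx => ⟨(hη i x hx).1.const_smul t, ?_⟩⟩, hcont.const_smul t, fun x hx => ?_⟩
  · rw [grad_smul (hη i x hx).1, (hη i x hx).2]
  · simp [hbd x hx]

theorem matNorm_nonneg {m N : ℕ} (ξ : Matrix (Fin m) (Fin N) ℝ) : 0 ≤ matNorm ξ :=
  Real.sqrt_nonneg _

theorem abs_apply_le_matNorm {m N : ℕ} (ξ : Matrix (Fin m) (Fin N) ℝ) (a : Fin m) (b : Fin N) :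
    |ξ a b| ≤ matNorm ξ := by
  refine Real.abs_le_sqrt ?_
  have h1 := Finset.single_le_sum (f := fun j => ξ a j ^ 2) (fun _ _ => sq_nonneg _)
    (Finset.mem_univ b)
  have h2 := Finset.single_le_sum (f := fun i => ∑ j, ξ i j ^ 2)
    (fun _ _ => Finset.sum_nonneg fun _ _ => sq_nonneg _) (Finset.mem_univ a)
  exact h1.trans h2

theorem matNorm_le_mul_of_abs_apply_le {N : ℕ} {ξ : Matrix (Fin N) (Fin N) ℝ} {R : ℝ}
    (hR : 0 ≤ R) (h : ∀ a b, |ξ a b| ≤ R) : matNorm ξ ≤ N * R := by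
  refine Real.sqrt_le_iff.2 ⟨by positivity, ?_⟩
  calc ∑ a, ∑ b, ξ a b ^ 2 ≤ ∑ _a : Fin N, ∑ _b : Fin N, R ^ 2 :=
        Finset.sum_le_sum fun a _ => Finset.sum_le_sum fun b _ => sq_le_sq.2
          ((h a b).trans (le_abs_self R))
    _ = (N * R) ^ 2 := by simp; ring

/-- The absolute value of the determinant is bounded below near an invertible matrix. -/
theorem eventually_le_abs_det {N : ℕ} {η : Matrix (Fin N) (Fin N) ℝ} (hη : η.det ≠ 0) :
    ∀ᶠ ε in nhdsWithin (0 : ℝ) (Set.Ioi 0), ∀ ζ : Matrix (Fin N) (Fin N) ℝ,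
      (∀ a b, |ζ a b - η a b| ≤ ε) → ε ≤ |ζ.det| := by
  have hcont : Continuous fun ζ : Fin N → Fin N → ℝ => |(Matrix.of ζ).det| :=
    (Continuous.matrix_det (by exact continuous_id)).abs
  obtain ⟨d, hd, hball⟩ := Metric.continuous_iff.1 hcont η (|η.det| / 2)
    (half_pos (abs_pos.2 hη))
  have hpos : 0 < min d (|η.det| / 2) := lt_min hd (half_pos (abs_pos.2 hη))
  filter_upwards [Ioo_mem_nhdsGT hpos] with ε hε ζ hζ
  have hdist : dist (α := Fin N → Fin N → ℝ) ζ η < d :=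
    lt_of_le_of_lt ((dist_pi_le_iff hε.1.le).2 fun a => (dist_pi_le_iff hε.1.le).2 fun b =>
      hζ a b) (hε.2.trans_le (min_le_left _ _))
  have h := hball ζ hdist
  rw [Real.dist_eq, abs_lt] at h
  have h1 : -(|η.det| / 2) < |ζ.det| - |η.det| := h.1
  linarith [hε.2.trans_le (min_le_right d (|η.det| / 2))]

theorem one_add_rpow_le {p x : ℝ} (hp : 0 ≤ p) (hx : 0 ≤ x) :
    (1 + x) ^ p ≤ 2 ^ p * (1 + x ^ p) := by
  have hxp := Real.rpow_nonneg hx p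
  rcases le_total x 1 with h | h
  · calc (1 + x) ^ p ≤ 2 ^ p := Real.rpow_le_rpow (by positivity) (by linarith) hp
      _ ≤ 2 ^ p * (1 + x ^ p) := le_mul_of_one_le_right (by positivity) (by linarith)
  · calc (1 + x) ^ p ≤ (2 * x) ^ p := Real.rpow_le_rpow (by positivity) (by linarith) hp
      _ = 2 ^ p * x ^ p := Real.mul_rpow (by norm_num) hx
      _ ≤ 2 ^ p * (1 + x ^ p) := by gcongr; linarith

/-- Shifts of an arbitrary matrix by a comparably large multiple of one of finitely many invertible
matrices have determinant bounded away from zero. -/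
theorem exists_pos_le_abs_det_add_smul {N : ℕ} {ι : Type*} [Fintype ι]
    {η : ι → Matrix (Fin N) (Fin N) ℝ} (hη : ∀ i, (η i).det ≠ 0) :
    ∃ δ : ℝ, 0 < δ ∧ ∃ C : ℝ, 0 ≤ C ∧ ∀ ξ : Matrix (Fin N) (Fin N) ℝ, ∃ t : ℝ, ∀ i,
      δ ≤ |(ξ + t • η i).det| ∧ matNorm (ξ + t • η i) ≤ C * (1 + matNorm ξ) := by
  -- Finitely many `η i` share one `ε`, both entrywise tolerance and determinant bound; `ε < 1`
  -- gives `t ≥ 1`, so the factor `t ^ N` cannot lower the determinant.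
  obtain ⟨ε, hdet, hε0, hε1⟩ := ((Filter.eventually_all.2 fun i =>
    eventually_le_abs_det (hη i)).and (Ioo_mem_nhdsGT one_pos)).exists
  let M : ℝ := ∑ i, ∑ a, ∑ b, |η i a b|
  have hM0 : 0 ≤ M := by positivity
  have hM : ∀ i a b, |η i a b| ≤ M := fun i a b =>
    (Finset.single_le_sum (f := fun b => |η i a b|) (fun _ _ => by positivity)
      (Finset.mem_univ b)).trans <|
    (Finset.single_le_sum (f := fun a => ∑ b, |η i a b|) (fun _ _ => by positivity)
      (Finset.mem_univ a)).trans <|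
    Finset.single_le_sum (f := fun i => ∑ a, ∑ b, |η i a b|) (fun _ _ => by positivity)
      (Finset.mem_univ i)
  refine ⟨ε, hε0, N * (1 + M / ε), by positivity, fun ξ => ⟨(1 + matNorm ξ) / ε, fun i => ?_⟩⟩
  have hξ := matNorm_nonneg ξ
  set t := (1 + matNorm ξ) / ε with ht
  have ht1 : 1 ≤ t := (one_le_div hε0).2 (by linarith)
  have ht0 : 0 < t := by linarith
  constructor
  · have hfac : ξ + t • η i = t • (t⁻¹ • ξ + η i) := by
      rw [smul_add, smul_inv_smul₀ ht0.ne']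
    rw [hfac, Matrix.det_smul, abs_mul, abs_of_pos (by positivity)]
    refine (hdet i _ fun a b => ?_).trans
      (le_mul_of_one_le_left (abs_nonneg _) (one_le_pow₀ ht1))
    have hentry := abs_apply_le_matNorm ξ a b
    simp only [Matrix.add_apply, Matrix.smul_apply, smul_eq_mul, add_sub_cancel_right]
    rw [abs_mul, abs_of_pos (inv_pos.2 ht0), inv_mul_le_iff₀ ht0, ht, div_mul_cancel₀ _ hε0.ne']
    linarith
  · rw [mul_assoc]
    refine matNorm_le_mul_of_abs_apply_le (by positivity) fun a b => ?_
    calc |(ξ + t • η i) a b| ≤ |ξ a b| + |t * η i a b| := abs_add_le _ _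
      _ ≤ matNorm ξ + t * M := by
          rw [abs_mul, abs_of_pos ht0]
          gcongr
          · exact abs_apply_le_matNorm ξ a b
          · exact hM i a b
      _ ≤ (1 + M / ε) * (1 + matNorm ξ) := by
          rw [ht]
          have : (1 + matNorm ξ) / ε * M = M / ε * (1 + matNorm ξ) := by ring
          rw [this]
          linarith

/-! ### The growth estimate -/

/-- Condition `C₃` alone makes `𝒵W` of polynomial growth: every `ξ` is shifted by a multiple of a
fixed piecewise affine map with invertible gradients. -/
theorem CondC₃.hasPolynomialGrowth_Z {p : ℝ} (hp0 : 0 ≤ p)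
    {W : Matrix (Fin 3) (Fin 3) ℝ → ℝ≥0∞} (hC₃ : CondC₃ p W) : HasPolynomialGrowth p (Z W) := by
  have hopen := isOpen_unitCube 3
  obtain ⟨u, ⟨K, hK⟩, hu0, n, U, η, hU, hdisj, hcov, hdet, hgrad⟩ :=
    exists_lipschitz_piecewise_invertible_grad hopen
  have hu : u ∈ Aff₀ 3 (unitCube 3) :=
    ⟨⟨⟨K, hK.lipschitzOnWith⟩, n, U, η, hU, hdisj, hcov, hgrad⟩, hK.continuous.continuousOn,
      fun x hx => hu0 x (hopen.frontier_eq ▸ hx).2⟩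
  obtain ⟨δ, hδ, C, hC, hshift⟩ := exists_pos_le_abs_det_add_smul hdet
  obtain ⟨c, hc, hWc⟩ := hC₃ δ hδ
  -- From `(C * (1 + x)) ^ p ≤ C ^ p * 2 ^ p * (1 + x ^ p)`.
  refine ⟨c * (1 + C ^ p * 2 ^ p), by positivity, fun ξ => ?_⟩
  obtain ⟨t, ht⟩ := hshift ξ
  have hξ := matNorm_nonneg ξ
  have hξp := Real.rpow_nonneg hξ p
  have hbound : ∀ i, W (ξ + t • η i) ≤
      ENNReal.ofReal (c * (1 + C ^ p * 2 ^ p) * (1 + matNorm ξ ^ p)) := by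
    intro i
    refine (hWc _ (ht i).1).trans (ENNReal.ofReal_le_ofReal ?_)
    rw [mul_assoc]
    gcongr
    calc 1 + matNorm (ξ + t • η i) ^ p ≤ 1 + (C * (1 + matNorm ξ)) ^ p := by
          gcongr
          · exact matNorm_nonneg _
          · exact (ht i).2
      _ = 1 + C ^ p * (1 + matNorm ξ) ^ p := by rw [Real.mul_rpow hC (by positivity)]
      _ ≤ 1 + C ^ p * (2 ^ p * (1 + matNorm ξ ^ p)) := by
          gcongr
          exact one_add_rpow_le hp0 hξ
      _ ≤ (1 + C ^ p * 2 ^ p) * (1 + matNorm ξ ^ p) := by linarith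
  have hae : ∀ᵐ y ∂volume.restrict (unitCube 3), W (ξ + grad (t • u) y) ≤
      ENNReal.ofReal (c * (1 + C ^ p * 2 ^ p) * (1 + matNorm ξ ^ p)) := by
    rw [ae_restrict_iff' hopen.measurableSet]
    refine measure_mono_null (fun y hy => ?_) hcov
    simp only [Set.mem_compl_iff, Set.mem_ofPred_eq, Classical.not_imp] at hy
    refine ⟨hy.1, fun hmem => hy.2 ?_⟩
    obtain ⟨i, hi⟩ := Set.mem_iUnion.1 hmem
    rw [grad_smul (hgrad i y hi).1, (hgrad i y hi).2]
    exact hbound i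
  calc Z W ξ ≤ ∫⁻ y in unitCube 3, W (ξ + grad (t • u) y) :=
        iInf₂_le (t • u) (smul_mem_Aff₀ hu t)
    _ ≤ ∫⁻ _ in unitCube 3,
          ENNReal.ofReal (c * (1 + C ^ p * 2 ^ p) * (1 + matNorm ξ ^ p)) := lintegral_mono_ae hae
    _ = _ := by rw [setLIntegral_const, volume_unitCube, mul_one]

end Relax

theorem proposition1p8 (p : ℝ) (hp : 1 < p)
    (W : Matrix (Fin 3) (Fin 3) ℝ → ℝ≥0∞) (hW : Measurable W)
    (hC₃ : Relax.CondC₃ p W) (hC₄ : Relax.CondC₄ W) :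
    Relax.HasPolynomialGrowth p (Relax.Z W) :=
  hC₃.hasPolynomialGrowth_Z (by linarith)
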